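/- Let $m, d \ge 0$ be integers, let $S^m \subset \mathbb{R}^{m+1}$ be the unit sphere, and let $f : S^m \to \mathbb{R}^d$ be a continuous map. Suppose that at least one of the following conditions holds: (1) $m > d$; (2) $f$ is odd, that is, $f(-p) = -f(p)$ for all $p \in S^m$, and $m = d$ is odd. Then there exist points $p_1, p_2 \in S^m$ with $p_1 \ne p_2$, $p_1 \ne -p_2$ and $f(p_1) = f(p_2)$, and there exists a point $p_0 \in S^m$ with $f(p_0) = f(-p_0)$. -/

import Mathlib

/-! ### Mod 2 cochains on ordered tuples

Cochains are functions `List V → ZMod 2`; a list of length `k + 1` plays the role of an ordered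
`k`-simplex. -/

/-! The core is that an odd continuous map F from the n-sphere to ℝⁿ has a zero. On the ℓ¹ sphere,
give each coordinate of F an odd ℤ/2-valued sign s_j. Mod 2 hemisphere chains c_k with ∂c_{k+1} =
c_k + A c_k, A the antipode (`hemisphere_coboundary`), can be built from arbitrarily small
simplices, and the cup product of δs_0, …, δs_{n-1} takes the value 1 on c_n
(`fineHemisphere_cupCocycle`). Hence all the signs change on some small simplex, F is small there,
and compactness yields a zero (`exists_eq_zero_of_odd_crossSphere`).

Applied to g(p) - g(-p) this gives `borsuk_ulam`, hence p₀. For the other pair, if m > d, restrict f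
to a parallel (m-1)-sphere off the equator: antipodes there are neither equal nor antipodal in the
big sphere. If f is odd and m is odd, apply `borsuk_ulam` to f(p) - f(Jp), where J² = -1. -/

namespace BorsukUlam

section Cochains

variable {V : Type*}

/-- The simplicial coboundary mod 2. -/
def coboundary : (List V → ZMod 2) → List V → ZMod 2
  | _, [] => 0
  | φ, v :: l => φ l + coboundary (fun l' => φ (v :: l')) l

/-- The dual prism operator of the pair of maps `g`, `h`. -/
def prism (g h : V → V) : (List V → ZMod 2) → List V → ZMod 2
  | _, [] => 0
  | φ, v :: l => φ (g v :: h v :: l.map h) + prism g h (fun l' => φ (g v :: l')) l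

/-- The transfer `φ + A^* φ`. -/
def transfer (A : V → V) (φ : List V → ZMod 2) (l : List V) : ZMod 2 :=
  φ l + φ (l.map A)

/-- The sum of the prism operators of consecutive maps of a discrete homotopy. -/
def homotopyOp (h : ℕ → V → V) (N : ℕ) (φ : List V → ZMod 2) (l : List V) : ZMod 2 :=
  ∑ j ∈ Finset.range N, prism (h j) (h (j + 1)) φ l

theorem coboundary_add (φ ψ : List V → ZMod 2) (l : List V) :
    coboundary (fun l => φ l + ψ l) l = coboundary φ l + coboundary ψ l := by
  induction l generalizing φ ψ with
  | nil => simp [coboundary]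
  | cons v l ih => simp only [coboundary, ih]; ring

theorem coboundary_const_mul (c : ZMod 2) (φ : List V → ZMod 2) (l : List V) :
    coboundary (fun l => c * φ l) l = c * coboundary φ l := by
  induction l generalizing φ with
  | nil => simp [coboundary]
  | cons v l ih => simp only [coboundary, ih]; ring

theorem coboundary_sum {ι : Type*} (s : Finset ι) (φ : ι → List V → ZMod 2) (l : List V) :
    coboundary (fun l => ∑ j ∈ s, φ j l) l = ∑ j ∈ s, coboundary (φ j) l := by
  induction l generalizing φ with
  | nil => simp [coboundary]
  | cons v l ih => simp only [coboundary, ih, Finset.sum_add_distrib]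

theorem coboundary_map (A : V → V) (φ : List V → ZMod 2) (l : List V) :
    coboundary (fun l => φ (l.map A)) l = coboundary φ (l.map A) := by
  induction l generalizing φ with
  | nil => simp [coboundary]
  | cons v l ih =>
    simp only [coboundary, List.map_cons]
    rw [ih (fun l' => φ (A v :: l'))]

theorem prism_add (g h : V → V) (φ ψ : List V → ZMod 2) (l : List V) :
    prism g h (fun l => φ l + ψ l) l = prism g h φ l + prism g h ψ l := by
  induction l generalizing φ ψ with
  | nil => simp [prism]
  | cons v l ih => simp only [prism, ih]; ring

/-- The prism operator is a cochain homotopy between `g^*` and `h^*`. -/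
theorem prism_coboundary (g h : V → V) (φ : List V → ZMod 2) (l : List V) :
    prism g h (coboundary φ) l =
      coboundary (prism g h φ) l + φ (l.map g) + φ (l.map h) := by
  induction l generalizing φ with
  | nil => simp [prism, coboundary, CharTwo.add_self_eq_zero]
  | cons v l ih =>
    simp only [prism, coboundary, List.map_cons, coboundary_add, prism_add, ih]
    rw [coboundary_map h (fun l' => φ (g v :: h v :: l'))]
    have e := CharTwo.add_self_eq_zero (φ (g v :: l.map h))
    linear_combination e

theorem homotopyOp_coboundary (h : ℕ → V → V) (N : ℕ) (φ : List V → ZMod 2) (l : List V) :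
    homotopyOp h N (coboundary φ) l =
      coboundary (homotopyOp h N φ) l + φ (l.map (h 0)) + φ (l.map (h N)) := by
  have e : coboundary (homotopyOp h N φ) l =
      ∑ j ∈ Finset.range N, coboundary (prism (h j) (h (j + 1)) φ) l :=
    coboundary_sum _ _ _
  rw [e]
  unfold homotopyOp
  induction N with
  | zero => simp [CharTwo.add_self_eq_zero]
  | succ N ih =>
    rw [Finset.sum_range_succ, Finset.sum_range_succ, ih (coboundary_sum _ _ _), prism_coboundary]
    have e := CharTwo.add_self_eq_zero (φ (l.map (h N)))
    linear_combination e

/-- If two cochains agree on all lists one step longer than `l` with entries of the form `g v`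
or `h v`, `v ∈ l`, then their prisms agree at `l`. -/
theorem prism_congr (g h : V → V) (φ ψ : List V → ZMod 2) (l : List V)
    (H : ∀ l' : List V, l'.length = l.length + 1 → (∀ x ∈ l', ∃ v ∈ l, x = g v ∨ x = h v) →
      φ l' = ψ l') :
    prism g h φ l = prism g h ψ l := by
  induction l generalizing φ ψ with
  | nil => rfl
  | cons v l ih =>
    simp only [prism]
    congr 1
    · apply H
      · simp
      · intro x hx
        simp only [List.mem_cons, List.mem_map] at hx
        rcases hx with rfl | rfl | ⟨w, hw, rfl⟩
        · exact ⟨v, by simp, Or.inl rfl⟩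
        · exact ⟨v, by simp, Or.inr rfl⟩
        · exact ⟨w, by simp [hw], Or.inr rfl⟩
    · apply ih
      intro l' hl' hx
      apply H
      · simp [hl']
      · intro x hx'
        rcases List.mem_cons.1 hx' with rfl | hx'
        · exact ⟨v, by simp, Or.inl rfl⟩
        · obtain ⟨w, hw, e⟩ := hx x hx'
          exact ⟨w, by simp [hw], e⟩

/-! ### Hemisphere chains and their boundaries -/

/-- Evaluation of cochains on a `k`-dimensional hemisphere chain, which is built by coning off
the double of the `(k - 1)`-dimensional one along the discrete homotopy `h (k - 1)`. -/
def hemisphere (A : V → V) (p : V) (h : ℕ → ℕ → V → V) (N : ℕ) :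
    ℕ → (List V → ZMod 2) → ZMod 2
  | 0, φ => φ [p]
  | k + 1, φ => hemisphere A p h N k (transfer A (homotopyOp (h k) N φ))

theorem hemisphere_add (A : V → V) (p : V) (h : ℕ → ℕ → V → V) (N k : ℕ)
    (φ ψ : List V → ZMod 2) :
    hemisphere A p h N k (fun l => φ l + ψ l) =
      hemisphere A p h N k φ + hemisphere A p h N k ψ := by
  induction k generalizing φ ψ with
  | zero => rfl
  | succ k ih =>
    simp only [hemisphere]
    rw [← ih]
    congr 1
    funext l
    simp only [transfer, homotopyOp, prism_add, Finset.sum_add_distrib]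
    ring

theorem hemisphere_zero (A : V → V) (p : V) (h : ℕ → ℕ → V → V) (N k : ℕ) :
    hemisphere A p h N k (fun _ => 0) = 0 := by
  simpa using hemisphere_add A p h N k (fun _ => 0) (fun _ => 0)

theorem transfer_transfer {A : V → V} (hA : Function.Involutive A) (φ : List V → ZMod 2) :
    transfer A (transfer A φ) = fun _ => 0 := by
  funext l
  simp only [transfer, List.map_map, hA.comp_self, List.map_id]
  have e₁ := CharTwo.add_self_eq_zero (φ l)
  have e₂ := CharTwo.add_self_eq_zero (φ (l.map A))
  linear_combination e₁ + e₂

theorem coboundary_transfer (A : V → V) (φ : List V → ZMod 2) :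
    coboundary (transfer A φ) = transfer A (coboundary φ) := by
  funext l
  unfold transfer
  rw [coboundary_add, coboundary_map]

/-- The boundary of the `(k + 1)`-dimensional hemisphere is the double of the `k`-dimensional
one. -/
theorem hemisphere_coboundary {A : V → V} (hA : Function.Involutive A) (p : V)
    {h : ℕ → ℕ → V → V} {N : ℕ} (h0 : ∀ k, h k 0 = id) (hN : ∀ k x y, h k N x = h k N y)
    (k : ℕ) (φ : List V → ZMod 2) :
    hemisphere A p h N (k + 1) (coboundary φ) = hemisphere A p h N k (transfer A φ) := by
  have key : hemisphere A p h N k (transfer A (coboundary (homotopyOp (h k) N φ))) = 0 := by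
    rw [← coboundary_transfer]
    cases k with
    -- The only face of a point is the empty list, where prisms vanish.
    | zero => simp [hemisphere, coboundary, transfer, homotopyOp, prism]
    | succ k =>
      rw [hemisphere_coboundary hA p h0 hN k, transfer_transfer hA, hemisphere_zero]
  have e : transfer A (homotopyOp (h k) N (coboundary φ)) =
      fun l => transfer A (coboundary (homotopyOp (h k) N φ)) l + transfer A φ l := by
    funext l
    -- The homotopy ends in a constant map, so its end terms at `l` and at the antipodal list
    -- coincide and cancel mod 2.
    have hc : (l.map A).map (h k N) = l.map (h k N) := by
      rw [List.map_map]
      exact List.map_congr_left fun x _ => hN k _ _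
    simp only [transfer, homotopyOp_coboundary, h0, List.map_id, hc]
    have e := CharTwo.add_self_eq_zero (φ (l.map (h k N)))
    linear_combination e
  rw [hemisphere, e, hemisphere_add, key, zero_add]

/-! ### Cup products of sign cochains -/

/-- The cup product of the coboundaries of the `0`-cochains `s i, s (i + 1), …`. -/
def cupCocycle (s : ℕ → V → ZMod 2) : ℕ → List V → ZMod 2
  | _, [] => 0
  | _, [_] => 1
  | i, v :: u :: l => (s i v + s i u) * cupCocycle s (i + 1) (u :: l)

/-- A cochain with coboundary `cupCocycle s i`. -/
def cupPrimitive (s : ℕ → V → ZMod 2) : ℕ → List V → ZMod 2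
  | _, [] => 0
  | i, [v] => s i v
  | i, v :: u :: l => (s i v + s i u) * cupPrimitive s (i + 1) (u :: l)

/-- Leibniz rule: only the last factor of the primitive is not already a coboundary. The formula
fails on singletons, where the two sides are 0 and 1. -/
theorem coboundary_cupPrimitive (s : ℕ → V → ZMod 2) (i : ℕ) (v u : V) (l : List V) :
    coboundary (cupPrimitive s i) (v :: u :: l) = cupCocycle s i (v :: u :: l) := by
  induction l generalizing i v u with
  | nil => simp [coboundary, cupPrimitive, cupCocycle, add_comm]
  | cons x l ih =>
    have h₁ := ih (i + 1) u x
    rw [coboundary] at h₁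
    rw [coboundary, coboundary]
    simp only [cupPrimitive, coboundary_const_mul] at h₁ ⊢
    rw [cupCocycle, ← h₁]
    have e := CharTwo.add_self_eq_zero (s i x * cupPrimitive s (i + 1) (x :: l))
    linear_combination e

/-- The differences of signs are invariant under `A`, while the last, undifferentiated factor shifts
by 1; the two terms therefore add up to the product of differences alone. -/
theorem transfer_cupPrimitive {s : ℕ → V → ZMod 2} {A : V → V} {l : List V} (hl : l ≠ [])
    (hs : ∀ i, ∀ x ∈ l, s i (A x) = s i x + 1) (i : ℕ) :
    transfer A (cupPrimitive s i) l = cupCocycle s i l := by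
  induction l generalizing i with
  | nil => exact absurd rfl hl
  | cons v l ih =>
    cases l with
    | nil =>
      simp only [transfer, cupPrimitive, List.map_cons, List.map_nil, cupCocycle, hs i v (by simp)]
      linear_combination CharTwo.add_self_eq_zero (s i v)
    | cons u l =>
      have h₁ := ih (by simp) (fun i x hx => hs i x (List.mem_cons_of_mem _ hx)) (i + 1)
      simp only [transfer, List.map_cons, cupPrimitive, cupCocycle] at h₁ ⊢
      rw [hs i v (by simp), hs i u (by simp), ← h₁]
      have e : (1 : ZMod 2) + 1 = 0 := CharTwo.add_self_eq_zero 1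
      linear_combination cupPrimitive s (i + 1) (A u :: l.map A) * e

theorem exists_ne_of_cupCocycle_ne_zero {s : ℕ → V → ZMod 2} {i : ℕ} {l : List V}
    (hl : cupCocycle s i l ≠ 0) {j : ℕ} (hj : j + 1 < l.length) :
    ∃ x ∈ l, ∃ y ∈ l, s (i + j) x ≠ s (i + j) y := by
  induction l generalizing i j with
  | nil => simp at hj
  | cons v l ih =>
    cases l with
    | nil => simp at hj
    | cons u l =>
      rw [cupCocycle] at hl
      cases j with
      | zero =>
        refine ⟨v, by simp, u, by simp, fun e => hl ?_⟩
        rw [add_zero] at e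
        rw [e, CharTwo.add_self_eq_zero, zero_mul]
      | succ j =>
        obtain ⟨x, hx, y, hy, e⟩ := ih (right_ne_zero_of_mul hl) (j := j) (by simpa using hj)
        refine ⟨x, List.mem_cons_of_mem _ hx, y, List.mem_cons_of_mem _ hy, ?_⟩
        rwa [show i + (j + 1) = i + 1 + j by ring]

end Cochains

end BorsukUlam

/-! ### Fine hemispheres in the cross-polytope -/

namespace BorsukUlam

section CrossPolytope

/-- The boundary of the cross-polytope: the unit sphere of the `ℓ¹` norm. -/
def crossSphere (n : ℕ) : Set (Fin (n + 1) → ℝ) := {x | ∑ i, |x i| = 1}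

/-- The `k`-th standard basis vector, and `0` if there is none. -/
def axis (n k : ℕ) : Fin (n + 1) → ℝ := fun i => if i.val = k then 1 else 0

/-- The straight-line homotopy in `N` steps from the identity to the next basis vector. -/
noncomputable def coneStep (n N k j : ℕ) (x : Fin (n + 1) → ℝ) : Fin (n + 1) → ℝ :=
  (1 - (j : ℝ) / N) • x + ((j : ℝ) / N) • axis n (k + 1)

/-- Ordered `k`-simplices of diameter at most `2 k / N` with vertices in the `k`-dimensional
coordinate subsphere. -/
structure IsFineSimplex (n N k : ℕ) (l : List (Fin (n + 1) → ℝ)) : Prop where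
  length_eq : l.length = k + 1
  mem : ∀ x ∈ l, x ∈ crossSphere n
  eq_zero : ∀ x ∈ l, ∀ i : Fin (n + 1), k < i.val → x i = 0
  dist_le : ∀ x ∈ l, ∀ y ∈ l, ‖x - y‖ ≤ 2 * k / N

variable {n N : ℕ}

theorem neg_mem_crossSphere {x : Fin (n + 1) → ℝ} (hx : x ∈ crossSphere n) :
    -x ∈ crossSphere n := by
  simpa [crossSphere] using hx

theorem ne_zero_of_mem_crossSphere {x : Fin (n + 1) → ℝ} (hx : x ∈ crossSphere n) : x ≠ 0 := by
  rintro rfl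
  simp [crossSphere] at hx

theorem norm_le_one_of_mem_crossSphere {x : Fin (n + 1) → ℝ} (hx : x ∈ crossSphere n) :
    ‖x‖ ≤ 1 := by
  rw [pi_norm_le_iff_of_nonneg zero_le_one]
  intro i
  have hx' : ∑ i, |x i| = 1 := hx
  rw [← hx', Real.norm_eq_abs]
  exact Finset.single_le_sum (f := fun i => |x i|) (fun i _ => abs_nonneg _) (Finset.mem_univ i)

theorem isCompact_crossSphere (n : ℕ) : IsCompact (crossSphere n) := by
  refine Metric.isCompact_of_isClosed_isBounded ?_ ?_
  · exact isClosed_eq (by fun_prop) continuous_const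
  · refine (Metric.isBounded_closedBall (x := 0) (r := 1)).subset fun x hx => ?_
    simpa using norm_le_one_of_mem_crossSphere hx

theorem sum_axis {k : ℕ} (hk : k ≤ n) : ∑ i, axis n k i = 1 := by
  rw [Finset.sum_eq_single (⟨k, by omega⟩ : Fin (n + 1))]
  · simp [axis]
  · intro b _ hb
    simpa [axis, Fin.ext_iff] using hb
  · simp

theorem axis_mem {k : ℕ} (hk : k ≤ n) : axis n k ∈ crossSphere n := by
  have h : ∀ i, |axis n k i| = axis n k i := fun i => by
    unfold axis; split_ifs <;> simp
  simp [crossSphere, h, sum_axis hk]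

theorem IsFineSimplex.map_neg {k : ℕ} {l : List (Fin (n + 1) → ℝ)} (h : IsFineSimplex n N k l) :
    IsFineSimplex n N k (l.map fun x => -x) where
  length_eq := by simpa using h.length_eq
  mem x hx := by
    obtain ⟨y, hy, rfl⟩ := List.mem_map.1 hx
    exact neg_mem_crossSphere (h.mem y hy)
  eq_zero x hx i hi := by
    obtain ⟨y, hy, rfl⟩ := List.mem_map.1 hx
    simp [h.eq_zero y hy i hi]
  dist_le x hx y hy := by
    obtain ⟨v, hv, rfl⟩ := List.mem_map.1 hx
    obtain ⟨w, hw, rfl⟩ := List.mem_map.1 hy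
    rw [neg_sub_neg]
    exact h.dist_le w hw v hv

/-- The ℓ¹ norm is additive on disjoint supports, so the segment to the next basis vector stays on
the sphere. This is the advantage of the cross-polytope: coning needs no renormalization. -/
theorem coneStep_mem {k j : ℕ} (hk : k + 1 ≤ n) (hj : j ≤ N) {x : Fin (n + 1) → ℝ}
    (hx : x ∈ crossSphere n) (hx0 : ∀ i : Fin (n + 1), k < i.val → x i = 0) :
    coneStep n N k j x ∈ crossSphere n := by
  have ht1 : (j : ℝ) / N ≤ 1 := div_le_one_of_le₀ (by exact_mod_cast hj) (by positivity)
  have ht0 : 0 ≤ (j : ℝ) / N := by positivity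
  have e : ∀ i, |coneStep n N k j x i| =
      (1 - (j : ℝ) / N) * |x i| + ((j : ℝ) / N) * axis n (k + 1) i := by
    intro i
    simp only [coneStep, axis, Pi.add_apply, Pi.smul_apply, smul_eq_mul]
    split_ifs with hi
    · rw [hx0 i (by omega)]
      simp [abs_of_nonneg ht0]
    · rw [mul_zero, add_zero, add_zero, abs_mul, abs_of_nonneg (sub_nonneg.2 ht1)]
  have hx' : ∑ i, |x i| = 1 := hx
  change ∑ i, |coneStep n N k j x i| = 1
  simp only [e]
  rw [Finset.sum_add_distrib, ← Finset.mul_sum, ← Finset.mul_sum, hx', sum_axis hk]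
  ring

theorem norm_coneStep_sub_le {k a b : ℕ} (hk : k + 1 ≤ n) (ha : a ≤ N)
    (hab : |(a : ℝ) - b| ≤ 1) {x y : Fin (n + 1) → ℝ} (hy : y ∈ crossSphere n) :
    ‖coneStep n N k a x - coneStep n N k b y‖ ≤ ‖x - y‖ + 2 / N := by
  have ht1 : (a : ℝ) / N ≤ 1 := div_le_one_of_le₀ (by exact_mod_cast ha) (by positivity)
  have ht0 : 0 ≤ (a : ℝ) / N := by positivity
  have e : coneStep n N k a x - coneStep n N k b y =
      (1 - (a : ℝ) / N) • (x - y) + (((a : ℝ) - b) / N) • (axis n (k + 1) - y) := by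
    ext i
    simp only [coneStep, Pi.add_apply, Pi.sub_apply, Pi.smul_apply, smul_eq_mul]
    ring
  have h₁ : ‖(1 - (a : ℝ) / N) • (x - y)‖ ≤ ‖x - y‖ := by
    rw [norm_smul, Real.norm_of_nonneg (sub_nonneg.2 ht1)]
    exact mul_le_of_le_one_left (norm_nonneg _) (by linarith)
  have h₂ : ‖axis n (k + 1) - y‖ ≤ 2 := by
    have h₃ := norm_le_one_of_mem_crossSphere (axis_mem hk)
    have h₄ := norm_le_one_of_mem_crossSphere hy
    exact (norm_sub_le _ _).trans (by linarith)
  have h₅ : ‖((a : ℝ) - b) / N‖ ≤ 1 / N := by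
    rw [norm_div, Real.norm_eq_abs, Real.norm_natCast]
    gcongr
  rw [e]
  refine (norm_add_le _ _).trans (add_le_add h₁ ?_)
  rw [norm_smul]
  calc _ ≤ 1 / (N : ℝ) * 2 := by gcongr
    _ = 2 / N := by ring

/-- Only two consecutive steps of the homotopy occur in a prism, so coning costs 2 / N in diameter,
whence the bound 2 k / N. -/
theorem IsFineSimplex.coneStep {k j : ℕ} (hk : k + 1 ≤ n) (hj : j < N)
    {l l' : List (Fin (n + 1) → ℝ)} (h : IsFineSimplex n N k l) (hl : l'.length = l.length + 1)
    (hl' : ∀ x ∈ l', ∃ v ∈ l, x = coneStep n N k j v ∨ x = coneStep n N k (j + 1) v) :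
    IsFineSimplex n N (k + 1) l' := by
  have H : ∀ x ∈ l', ∃ v ∈ l, ∃ a ≤ N, (j ≤ a ∧ a ≤ j + 1) ∧
      x = BorsukUlam.coneStep n N k a v := by
    intro x hx
    obtain ⟨v, hv, e | e⟩ := hl' x hx
    · exact ⟨v, hv, j, by omega, by omega, e⟩
    · exact ⟨v, hv, j + 1, by omega, by omega, e⟩
  refine ⟨by rw [hl, h.length_eq], fun x hx => ?_, fun x hx i hi => ?_, fun x hx y hy => ?_⟩
  · obtain ⟨v, hv, a, ha, -, rfl⟩ := H x hx
    exact coneStep_mem hk ha (h.mem v hv) (h.eq_zero v hv)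
  · obtain ⟨v, hv, a, ha, -, rfl⟩ := H x hx
    have : i.val ≠ k + 1 := by omega
    simp [BorsukUlam.coneStep, axis, h.eq_zero v hv i (by omega), this]
  · obtain ⟨v, hv, a, ha, haj, rfl⟩ := H x hx
    obtain ⟨w, hw, b, hb, hbj, rfl⟩ := H y hy
    have hab : |(a : ℝ) - b| ≤ 1 := by
      rw [abs_le]
      constructor
      · have : (b : ℝ) ≤ a + 1 := by exact_mod_cast (by omega : b ≤ a + 1)
        linarith
      · have : (a : ℝ) ≤ b + 1 := by exact_mod_cast (by omega : a ≤ b + 1)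
        linarith
    refine (norm_coneStep_sub_le hk ha hab (h.mem w hw)).trans ?_
    have := h.dist_le v hv w hw
    calc _ ≤ 2 * (k : ℝ) / N + 2 / N := by gcongr
      _ = _ := by push_cast; ring

/-- Evaluation on the fine `k`-dimensional hemisphere chain of `crossSphere n`. -/
noncomputable def fineHemisphere (n N k : ℕ) (φ : List (Fin (n + 1) → ℝ) → ZMod 2) : ZMod 2 :=
  hemisphere (fun x => -x) (axis n 0) (coneStep n N) N k φ

/-- Expresses that the hemisphere chain is supported on fine simplices, without ever writing the
chain down. -/
theorem fineHemisphere_congr {k : ℕ} (hk : k ≤ n) {φ ψ : List (Fin (n + 1) → ℝ) → ZMod 2}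
    (H : ∀ l, IsFineSimplex n N k l → φ l = ψ l) :
    fineHemisphere n N k φ = fineHemisphere n N k ψ := by
  induction k generalizing φ ψ with
  | zero =>
    apply H
    refine ⟨rfl, fun x hx => ?_, fun x hx i hi => ?_, fun x hx y hy => ?_⟩
    · rw [List.mem_singleton.1 hx]
      exact axis_mem hk
    · rw [List.mem_singleton.1 hx]
      simp [axis, hi.ne']
    · rw [List.mem_singleton.1 hx, List.mem_singleton.1 hy]
      simp
  | succ k ih =>
    apply ih (by omega)
    intro l hl
    have key : ∀ l, IsFineSimplex n N k l →
        homotopyOp (coneStep n N k) N φ l = homotopyOp (coneStep n N k) N ψ l := by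
      intro l hl
      refine Finset.sum_congr rfl fun j hj => prism_congr _ _ _ _ _ fun l' h₁ h₂ => H l' ?_
      exact hl.coneStep hk (Finset.mem_range.1 hj) h₁ h₂
    simp only [transfer, key l hl, key _ hl.map_neg]

/-- Induction by Stokes: the cocycle is the coboundary of `cupPrimitive`, the boundary of the
hemisphere is the double of the previous one, and the transfer of the primitive is the cocycle one
degree lower. -/
theorem fineHemisphere_cupCocycle (hN : N ≠ 0) {s : ℕ → (Fin (n + 1) → ℝ) → ZMod 2}
    (hs : ∀ i, ∀ x ∈ crossSphere n, s i (-x) = s i x + 1) {k : ℕ} (hk : k ≤ n) :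
    fineHemisphere n N k (cupCocycle s 0) = 1 := by
  induction k with
  | zero => rfl
  | succ k ih =>
    rw [← ih (by omega)]
    have e₁ : fineHemisphere n N (k + 1) (cupCocycle s 0) =
        fineHemisphere n N (k + 1) (coboundary (cupPrimitive s 0)) := by
      refine fineHemisphere_congr hk fun l hl => ?_
      match l, hl.length_eq with
      | v :: u :: l, _ => rw [coboundary_cupPrimitive]
    have e₂ : fineHemisphere n N k (transfer (fun x => -x) (cupPrimitive s 0)) =
        fineHemisphere n N k (cupCocycle s 0) := by
      refine fineHemisphere_congr (by omega) fun l hl => ?_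
      refine transfer_cupPrimitive ?_ (fun i x hx => hs i x (hl.mem x hx)) 0
      rintro rfl
      simpa using hl.length_eq
    rw [e₁, ← e₂]
    refine hemisphere_coboundary neg_involutive _ (fun k => ?_) (fun k x y => ?_) k _
    · funext x
      simp [coneStep]
    · have : (N : ℝ) ≠ 0 := by exact_mod_cast hN
      simp [coneStep, this]

/-- A family of sign functions on the cross-polytope sphere, each of them odd, changes sign
simultaneously at some arbitrarily small scale. -/
theorem exists_small_sign_changes {s : ℕ → (Fin (n + 1) → ℝ) → ZMod 2}
    (hs : ∀ i, ∀ x ∈ crossSphere n, s i (-x) = s i x + 1) {δ : ℝ} (hδ : 0 < δ) :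
    ∃ l : List (Fin (n + 1) → ℝ), l ≠ [] ∧ (∀ x ∈ l, x ∈ crossSphere n) ∧
      (∀ x ∈ l, ∀ y ∈ l, dist x y < δ) ∧
      ∀ j < n, ∃ x ∈ l, ∃ y ∈ l, s j x ≠ s j y := by
  -- This makes the diameter bound 2 n / N smaller than δ.
  obtain ⟨N, hN⟩ := exists_nat_gt (2 * n / δ)
  have hN0 : (0 : ℝ) < N := lt_of_le_of_lt (by positivity) hN
  have hne : N ≠ 0 := by exact_mod_cast hN0.ne'
  by_contra! hcon
  have h₁ : fineHemisphere n N n (cupCocycle s 0) = fineHemisphere n N n (fun _ => 0) := by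
    refine fineHemisphere_congr le_rfl fun l hl => ?_
    by_contra h0
    have hl0 : l ≠ [] := by
      rintro rfl
      simpa using hl.length_eq
    obtain ⟨j, hj, hjs⟩ := hcon l hl0 hl.mem fun x hx y hy => by
      rw [dist_eq_norm]
      refine (hl.dist_le x hx y hy).trans_lt ?_
      rw [div_lt_iff₀ hN0]
      rw [div_lt_iff₀ hδ] at hN
      linarith
    obtain ⟨x, hx, y, hy, hxy⟩ := exists_ne_of_cupCocycle_ne_zero h0
      (j := j) (by rw [hl.length_eq]; omega)
    rw [zero_add] at hxy
    exact hxy (hjs x hx y hy)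
  rw [fineHemisphere_cupCocycle hne hs le_rfl, fineHemisphere, hemisphere_zero] at h₁
  exact one_ne_zero h₁

/-! ### From sign changes to zeros of odd maps -/

/-- An odd function to `ℤ/2` refining the sign of `g`. -/
theorem exists_sign {V : Type*} [AddCommGroup V] [IsAddTorsionFree V] (g : V → ℝ) :
    ∃ s : V → ZMod 2, (∀ x, x ≠ 0 → g (-x) = -g x → s (-x) = s x + 1) ∧
      ∀ x y, s x ≠ s y → g x * g y ≤ 0 := by
  classical
  -- Where `g` vanishes, a well-order chooses one point of each pair {x, -x}, so oddness persists;
  -- no continuity of the sign is needed.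
  refine ⟨fun x => if 0 < g x ∨ (g x = 0 ∧ WellOrderingRel x (-x)) then 1 else 0, ?_, ?_⟩
  · intro x hx hg
    have h2 : (0 : ZMod 2) = 1 + 1 := by decide
    have hne : x ≠ -x := fun e => hx (self_eq_neg.1 e)
    simp only [hg, neg_neg, Left.neg_pos_iff, neg_eq_zero]
    rcases lt_trichotomy (g x) 0 with h | h | h
    · simp [h, h.not_gt, h.ne]
    · rcases trichotomous_of WellOrderingRel x (-x) with hr | hr | hr
      · have hr' := asymm_of WellOrderingRel hr
        simp [h, hr, hr', ← h2]
      · exact absurd hr hne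
      · have hr' := asymm_of WellOrderingRel hr
        simp [h, hr, hr']
    · simp [h, h.not_gt, h.ne', ← h2]
  · intro x y h
    by_contra! hpos
    apply h
    rcases pos_and_pos_or_neg_and_neg_of_mul_pos hpos with ⟨h₁, h₂⟩ | ⟨h₁, h₂⟩
    · simp [h₁, h₂]
    · simp [h₁.not_gt, h₂.not_gt, h₁.ne, h₂.ne]

/-- Every odd continuous map from the cross-polytope sphere to `ℝⁿ` has a zero. -/
theorem exists_eq_zero_of_odd_crossSphere {F : (Fin (n + 1) → ℝ) → Fin n → ℝ}
    (hF : ContinuousOn F (crossSphere n)) (hodd : ∀ x ∈ crossSphere n, F (-x) = -F x) :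
    ∃ x ∈ crossSphere n, F x = 0 := by
  by_contra! hne
  obtain ⟨x₀, hx₀, hmin⟩ := (isCompact_crossSphere n).exists_isMinOn
    ⟨_, axis_mem (Nat.zero_le n)⟩ hF.norm
  have hη : 0 < ‖F x₀‖ := norm_pos_iff.2 (hne x₀ hx₀)
  have huc := (isCompact_crossSphere n).uniformContinuousOn_of_continuous hF
  obtain ⟨δ, hδ, hFδ⟩ := Metric.uniformContinuousOn_iff.1 huc (‖F x₀‖ / 2) (by positivity)
  choose s hs hs' using fun i : ℕ => exists_sign fun x : Fin (n + 1) → ℝ =>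
    -- The signs are indexed by ℕ; the padding beyond `n` is never used.
    if h : i < n then F x ⟨i, h⟩ else 0
  obtain ⟨l, hl, hmem, hdist, hsc⟩ := exists_small_sign_changes (n := n) (s := s)
    (fun i x hx => hs i x (ne_zero_of_mem_crossSphere hx) (by
      split_ifs
      · rw [hodd x hx, Pi.neg_apply]
      · simp)) hδ
  obtain ⟨v, hv⟩ := List.exists_mem_of_ne_nil l hl
  -- For each coordinate a sign change between x and y bounds |F x i| by |F x i - F y i|, less than
  -- half the minimum; moving from x to v costs less than another half.
  have hlt : ‖F v‖ < ‖F x₀‖ := by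
    rw [pi_norm_lt_iff hη]
    intro i
    obtain ⟨x, hx, y, hy, hxy⟩ := hsc i i.isLt
    have hsign : F x i * F y i ≤ 0 := by simpa using hs' i x y hxy
    have d₁ : |F x i - F y i| < ‖F x₀‖ / 2 := by
      rw [← Real.dist_eq]
      exact (dist_le_pi_dist _ _ i).trans_lt
        (hFδ x (hmem x hx) y (hmem y hy) (hdist x hx y hy))
    have d₂ : |F v i - F x i| < ‖F x₀‖ / 2 := by
      rw [← Real.dist_eq]
      exact (dist_le_pi_dist _ _ i).trans_lt
        (hFδ v (hmem v hv) x (hmem x hx) (hdist v hv x hx))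
    have d₃ : |F x i| ≤ |F x i - F y i| := by
      apply sq_le_sq.1
      nlinarith [sq_nonneg (F y i)]
    have d₄ : |F v i| ≤ |F v i - F x i| + |F x i| := by
      simpa using abs_add_le (F v i - F x i) (F x i)
    rw [Real.norm_eq_abs]
    linarith
  exact absurd (hmin (hmem v hv)) (not_le.2 hlt)

end CrossPolytope

end BorsukUlam

/-! ### The round sphere and the two cases -/

namespace BorsukUlam

section Sphere

open Metric

/-- The **Borsuk–Ulam theorem**. -/
theorem borsuk_ulam {n d : ℕ} (hd : d ≤ n)
    (g : sphere (0 : EuclideanSpace ℝ (Fin (n + 1))) 1 → EuclideanSpace ℝ (Fin d))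
    (hg : Continuous g) : ∃ p, g p = g (-p) := by
  have hK0 : ∀ x ∈ crossSphere n, ‖WithLp.toLp 2 x‖ ≠ 0 := fun x hx => by
    simpa using ne_zero_of_mem_crossSphere hx
  have hmem : ∀ x ∈ crossSphere n, ‖WithLp.toLp 2 x‖⁻¹ • WithLp.toLp 2 x ∈
      sphere (0 : EuclideanSpace ℝ (Fin (n + 1))) 1 := fun x hx => by
    rw [mem_sphere_zero_iff_norm, norm_smul, norm_inv, norm_norm, inv_mul_cancel₀ (hK0 x hx)]
  -- Radial projection, which commutes with the antipode.
  let σ : crossSphere n → sphere (0 : EuclideanSpace ℝ (Fin (n + 1))) 1 :=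
    fun x => ⟨_, hmem x x.2⟩
  have hσ : Continuous σ := by
    have h₁ : Continuous fun x : crossSphere n => WithLp.toLp 2 (x : Fin (n + 1) → ℝ) :=
      (PiLp.continuous_toLp 2 _).comp continuous_subtype_val
    exact ((h₁.norm.inv₀ fun x => hK0 x x.2).smul h₁).subtype_mk _
  have hσneg : ∀ x (hx : x ∈ crossSphere n),
      σ ⟨-x, neg_mem_crossSphere hx⟩ = -σ ⟨x, hx⟩ := fun x hx => by
    ext1
    simp [σ]
  classical
  -- The odd part of `g` up to a factor 2, padded with zero coordinates from `d` to `n`.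
  let F : (Fin (n + 1) → ℝ) → Fin n → ℝ := fun x i =>
    if hx : x ∈ crossSphere n then
      if hi : i.val < d then (g (σ ⟨x, hx⟩) - g (-σ ⟨x, hx⟩)) ⟨i, hi⟩ else 0
    else 0
  have hFc : ContinuousOn F (crossSphere n) := by
    rw [continuousOn_iff_continuous_domRestrict]
    refine continuous_pi fun i => ?_
    by_cases hi : i.val < d
    · have h₁ : Continuous fun x : crossSphere n =>
          (g (σ x) - g (-σ x)) (⟨i, hi⟩ : Fin d) := by fun_prop
      convert h₁ using 2 with x
      simp [F, hi]
    · convert continuous_const (y := (0 : ℝ)) using 2 with x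
      simp [F, hi]
  obtain ⟨x, hx, hFx⟩ := exists_eq_zero_of_odd_crossSphere hFc fun x hx => by
    funext i
    by_cases hi : i.val < d
    · simp [F, hx, neg_mem_crossSphere hx, hi, hσneg x hx]
    · simp [F, hi]
  refine ⟨σ ⟨x, hx⟩, ?_⟩
  ext i
  have h₁ := congrFun hFx (Fin.castLE hd i)
  simp only [F, hx, dif_pos, Fin.val_castLE, i.isLt, Pi.zero_apply, PiLp.sub_apply] at h₁
  exact sub_eq_zero.1 h₁

/-- A continuous map from a sphere to a Euclidean space of smaller dimension identifies two
points that are neither equal nor antipodal. -/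
theorem exists_eq_of_dim_lt {n d : ℕ} (hd : d ≤ n)
    (f : sphere (0 : EuclideanSpace ℝ (Fin (n + 1 + 1))) 1 → EuclideanSpace ℝ (Fin d))
    (hf : Continuous f) : ∃ p₁ p₂, p₁ ≠ p₂ ∧ p₁ ≠ -p₂ ∧ f p₁ = f p₂ := by
  -- The parallel at height 3/5 has radius 4/5. Positive radius keeps the images of antipodes
  -- distinct; nonzero height keeps them from being antipodal.
  let e : EuclideanSpace ℝ (Fin (n + 1)) → EuclideanSpace ℝ (Fin (n + 1 + 1)) :=
    fun x => WithLp.toLp 2 (Fin.cons (3 / 5) fun i => 4 / 5 * x i)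
  have he0 : ∀ x, e x 0 = 3 / 5 := fun x => rfl
  have hes : ∀ x (i : Fin (n + 1)), e x i.succ = 4 / 5 * x i := fun x i => rfl
  have hmem : ∀ x ∈ sphere (0 : EuclideanSpace ℝ (Fin (n + 1))) 1,
      e x ∈ sphere (0 : EuclideanSpace ℝ (Fin (n + 1 + 1))) 1 := fun x hx => by
    rw [mem_sphere_zero_iff_norm] at hx ⊢
    have hx2 : ∑ i, x i ^ 2 = 1 := by rw [← EuclideanSpace.real_norm_sq_eq, hx, one_pow]
    rw [← pow_eq_one_iff_of_nonneg (norm_nonneg _) two_ne_zero, EuclideanSpace.real_norm_sq_eq,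
      Fin.sum_univ_succ]
    simp only [he0, hes, mul_pow]
    rw [← Finset.mul_sum, hx2]
    norm_num
  have hec : Continuous e := by
    refine (PiLp.continuous_toLp 2 _).comp (continuous_pi fun i => ?_)
    refine Fin.cases ?_ (fun i => ?_) i
    · simpa using continuous_const
    · simp only [Fin.cons_succ]
      fun_prop
  let ι : sphere (0 : EuclideanSpace ℝ (Fin (n + 1))) 1 →
      sphere (0 : EuclideanSpace ℝ (Fin (n + 1 + 1))) 1 := fun x => ⟨e x, hmem x x.2⟩
  have hι : Continuous ι := (hec.comp continuous_subtype_val).subtype_mk _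
  obtain ⟨p, hp⟩ := borsuk_ulam hd (f ∘ ι) (hf.comp hι)
  refine ⟨ι p, ι (-p), fun h => ?_, fun h => ?_, hp⟩
  · refine ne_zero_of_mem_unit_sphere p ?_
    ext i
    have h₁ : e p i.succ = e (-p) i.succ := congrArg (fun q => q.val i.succ) h
    rw [hes, hes, PiLp.neg_apply] at h₁
    rw [PiLp.zero_apply]
    linarith
  · have h₁ : e p 0 = -e (-p) 0 := congrArg (fun q => q.val 0) h
    rw [he0, he0] at h₁
    norm_num at h₁

/-- An odd continuous map from an odd-dimensional sphere `Sᵐ` to `ℝᵐ` identifies two points that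
are neither equal nor antipodal: a point and its image under a complex structure. -/
theorem exists_eq_of_odd {m d : ℕ} (hd : d ≤ m) (hm : Odd m)
    (f : sphere (0 : EuclideanSpace ℝ (Fin (m + 1))) 1 → EuclideanSpace ℝ (Fin d))
    (hf : Continuous f) (hodd : ∀ p, f (-p) = -f p) :
    ∃ p₁ p₂, p₁ ≠ p₂ ∧ p₁ ≠ -p₂ ∧ f p₁ = f p₂ := by
  -- Reversal with alternating signs squares to (-1)^m, which is -1 because `m` is odd.
  let e : EuclideanSpace ℝ (Fin (m + 1)) → EuclideanSpace ℝ (Fin (m + 1)) :=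
    fun x => WithLp.toLp 2 fun i => (-1) ^ i.val * x i.rev
  have he : ∀ x i, e x i = (-1) ^ i.val * x i.rev := fun x i => rfl
  have hsign : ∀ i : Fin (m + 1), (-1 : ℝ) ^ i.rev.val = -(-1) ^ i.val := fun i => by
    have h₁ : i.rev.val + i.val = m := by rw [Fin.val_rev]; omega
    have h₂ : (-1 : ℝ) ^ i.rev.val * (-1) ^ i.val = -1 := by rw [← pow_add, h₁, hm.neg_one_pow]
    rcases neg_one_pow_eq_or ℝ i.val with h | h <;> rw [h] at h₂ ⊢ <;> linarith
  have hee : ∀ x, e (e x) = -x := fun x => by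
    ext i
    rw [he, he, Fin.rev_rev, hsign, PiLp.neg_apply]
    rcases neg_one_pow_eq_or ℝ i.val with h | h <;> rw [h] <;> ring
  have heneg : ∀ x, e (-x) = -e x := fun x => by
    ext i
    simp [he]
  have hmem : ∀ x ∈ sphere (0 : EuclideanSpace ℝ (Fin (m + 1))) 1,
      e x ∈ sphere (0 : EuclideanSpace ℝ (Fin (m + 1))) 1 := fun x hx => by
    rw [mem_sphere_zero_iff_norm] at hx ⊢
    rw [← hx, EuclideanSpace.norm_eq, EuclideanSpace.norm_eq]
    congr 1
    rw [← Equiv.sum_comp Fin.revPerm]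
    refine Finset.sum_congr rfl fun i _ => ?_
    simp [he]
  have hec : Continuous e := by
    refine (PiLp.continuous_toLp 2 _).comp (continuous_pi fun i => ?_)
    fun_prop
  let J : sphere (0 : EuclideanSpace ℝ (Fin (m + 1))) 1 →
      sphere (0 : EuclideanSpace ℝ (Fin (m + 1))) 1 := fun x => ⟨e x, hmem x x.2⟩
  have hJ : Continuous J := (hec.comp continuous_subtype_val).subtype_mk _
  have hJneg : ∀ p, J (-p) = -J p := fun p => Subtype.ext (heneg p)
  have hJJ : ∀ p, J (J p) = -p := fun p => Subtype.ext (hee p)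
  -- This difference is odd, so equal values at p and -p force it to vanish at p.
  obtain ⟨p, hp⟩ := borsuk_ulam hd (fun p => f p - f (J p)) (by fun_prop)
  have hne : p ≠ -p := by
    simpa [Subtype.ext_iff] using ne_neg_of_mem_unit_sphere ℝ p
  refine ⟨p, J p, fun h => hne ?_, fun h => hne ?_, ?_⟩
  · calc p = J (J p) := by rw [← h, ← h]
      _ = -p := hJJ p
  · have h' : J p = -p := (neg_eq_iff_eq_neg.2 h).symm
    calc p = J (J p) := by rw [h', hJneg, h', neg_neg]
      _ = -p := hJJ p
  · ext i
    have h₁ := congrArg (fun q => q.ofLp i) hp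
    simp only [hJneg, hodd, PiLp.sub_apply, PiLp.neg_apply] at h₁
    linarith

end Sphere

end BorsukUlam

theorem mainTheorem1 (m d : ℕ)
    (f : Metric.sphere (0 : EuclideanSpace ℝ (Fin (m + 1))) 1 → EuclideanSpace ℝ (Fin d))
    (hf : Continuous f)
    (h : d < m ∨ ((∀ p, f (-p) = -f p) ∧ m = d ∧ Odd m)) :
    (∃ p₁ p₂ : Metric.sphere (0 : EuclideanSpace ℝ (Fin (m + 1))) 1,
      p₁ ≠ p₂ ∧ p₁ ≠ -p₂ ∧ f p₁ = f p₂) ∧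
    (∃ p₀ : Metric.sphere (0 : EuclideanSpace ℝ (Fin (m + 1))) 1, f p₀ = f (-p₀)) := by
  have hd : d ≤ m := h.elim le_of_lt fun h => h.2.1.ge
  refine ⟨?_, BorsukUlam.borsuk_ulam hd f hf⟩
  rcases h with h | ⟨hodd, -, hm⟩
  · obtain _ | n := m
    · omega
    · exact BorsukUlam.exists_eq_of_dim_lt (by omega) f hf
  · exact BorsukUlam.exists_eq_of_odd hd hm f hf hodd
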